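/- **Conventions.** $K$ is a field; rings and $K$-algebras are associative but need not be unital or commutative; an ideal is a two-sided ideal. A ring is left (right) Artinian if its left (right) ideals satisfy the descending chain condition, and von Neumann regular if for every $x$ there is a $y$ with $xyx=x$. A (directed) hypergraph $H=(H^0,H^1,s,r)$ consists of sets $H^0$ (vertices) and $H^1$ (hyperedges) and maps $s,r$ that assign to each $h\in H^1$ nonempty finite multisets $s(h)=\{s(h)_1,\dots,s(h)_{|s(h)|}\}$ and $r(h)=\{r(h)_1,\dots,r(h)_{|r(h)|}\}$ of vertices, where $|\cdot|$ counts multiplicities. Its Leavitt path algebra $L_K(H)$ is the $K$-algebra presented by the generators $v$, $h_{ij}$, $h_{ij}^*$ ($v\in H^0$, $h\in H^1$, $1\le i\le |s(h)|$, $1\le j\le |r(h)|$) and the relations 1. $uv=\delta_{uv}u$ for $u,v\in H^0$; 2. $s(h)_ih_{ij}=h_{ij}=h_{ij}r(h)_j$ and $r(h)_jh_{ij}^*=h_{ij}^*=h_{ij}^*s(h)_i$; 3. $\sum_{k=1}^{|r(h)|}h_{ik}h_{jk}^*=\delta_{ij}s(h)_i$ for $1\le i,j\le|s(h)|$; 4.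 $\sum_{k=1}^{|s(h)|}h_{ki}^*h_{kj}=\delta_{ij}r(h)_i$ for $1\le i,j\le|r(h)|$. A finitely separated graph $(E,C)$ is a directed graph $E=(E^0,E^1,s,r)$ with, for each $v\in E^0$, a partition $C_v$ of $s^{-1}(v)$ into finite nonempty sets, and $C=\bigsqcup_v C_v$. Its Leavitt path algebra $L_K(E,C)$ is the $K$-algebra presented by the generators $v,e,e^*$ ($v\in E^0$, $e\in E^1$) and the relations $uv=\delta_{uv}u$; $s(e)e=e=er(e)$; $r(e)e^*=e^*=e^*s(e)$; $e^*f=\delta_{ef}r(e)$ for $e,f\in X\in C$; and $v=\sum_{e\in X}ee^*$ for $X\in C_v$. **Theorem.** Let $K$ be a field and $H$ a hypergraph. (a) If $H$ satisfies Condition (A), i.e. there is an $h\in H^1$ with $|s(h)|\ge 2$ and $|r(h)|\ge 2$, then $\dim_K L_K(H)=\infty$, $L_K(H)$ has infinitely many ideals, $L_K(H)$ is not simple, $L_K(H)$ is neither left nor right Artinian, and $L_K(H)$ is not von Neumann regular. (b) Consequently, if $L_K(H)$ is finite-dimensional over $K$, or has only finitely many ideals, or is simple, or left Artinian, or right Artinian,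 or von Neumann regular, then $L_K(H)$ is isomorphic, as a $K$-algebra, to $L_K(E,C)$ for some finitely separated graph $(E,C)$. -/

import Mathlib

universe u v w

noncomputable section

/-! ### Nonunital associative algebras given by generators and relations -/

/-- The free (associative, nonunital) `K`-algebra on `X`: finite linear combinations of nonempty
words over `X`, multiplied by juxtaposition. -/
abbrev FreeNUAlgebra (K : Type*) [Field K] (X : Type*) : Type _ :=
  MonoidAlgebra K (FreeSemigroup X)

/-- The generator of the free algebra attached to `x : X`. -/
def FreeNUAlgebra.gen (K : Type*) [Field K] {X : Type*} (x : X) : FreeNUAlgebra K X :=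
  MonoidAlgebra.single (FreeSemigroup.of x) 1

/-- The smallest congruence of `K`-algebras that contains the relation `r`. Since a congruence of
nonunital rings need not be stable under scalars, the scalar multiples of `r` are included. -/
def presCon {K X : Type*} [Field K] (r : FreeNUAlgebra K X → FreeNUAlgebra K X → Prop) :
    RingCon (FreeNUAlgebra K X) :=
  ringConGen fun a b => ∃ (k : K) (x y : FreeNUAlgebra K X), r x y ∧ a = k • x ∧ b = k • y

theorem presCon_smul {K X : Type*} [Field K] {r : FreeNUAlgebra K X → FreeNUAlgebra K X → Prop}
    (k : K) {a b : FreeNUAlgebra K X} (h : presCon r a b) : presCon r (k • a) (k • b) := by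
  change RingConGen.Rel _ a b at h
  change RingConGen.Rel _ (k • a) (k • b)
  induction h with
  | of a b h =>
    obtain ⟨l, x, y, hr, rfl, rfl⟩ := h
    exact .of _ _ ⟨k * l, x, y, hr, smul_smul _ _ _, smul_smul _ _ _⟩
  | refl x => exact .refl _
  | symm _ ih => exact .symm ih
  | trans _ _ ih₁ ih₂ => exact .trans ih₁ ih₂
  | add _ _ ih₁ ih₂ =>
    rw [smul_add, smul_add]
    exact .add ih₁ ih₂
  | mul _ h ih₁ _ =>
    rw [← smul_mul_assoc, ← smul_mul_assoc]
    exact .mul ih₁ h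

/-- The (associative, nonunital) `K`-algebra presented by the generating set `X` and the
relations `x = y` for all `x`, `y` with `r x y`. -/
def PresentedNUAlgebra {K X : Type*} [Field K]
    (r : FreeNUAlgebra K X → FreeNUAlgebra K X → Prop) : Type _ :=
  (presCon r).Quotient

namespace PresentedNUAlgebra

variable {K X : Type*} [Field K] (r : FreeNUAlgebra K X → FreeNUAlgebra K X → Prop)

instance : NonUnitalRing (PresentedNUAlgebra r) :=
  inferInstanceAs (NonUnitalRing (presCon r).Quotient)

/-- The class of an element of the free algebra. -/
def mk (a : FreeNUAlgebra K X) : PresentedNUAlgebra r :=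
  RingCon.toQuotient (c := presCon r) a

theorem mk_surjective : Function.Surjective (mk r) := fun x =>
  Quotient.inductionOn' x fun a => ⟨a, rfl⟩

instance : SMul K (PresentedNUAlgebra r) :=
  ⟨fun k => Quotient.map' (k • ·) fun _ _ h => presCon_smul k h⟩

theorem mk_add (a b : FreeNUAlgebra K X) : mk r (a + b) = mk r a + mk r b := rfl

theorem mk_mul (a b : FreeNUAlgebra K X) : mk r (a * b) = mk r a * mk r b := rfl

theorem mk_zero : mk r 0 = 0 := rfl

theorem mk_smul (k : K) (a : FreeNUAlgebra K X) : mk r (k • a) = k • mk r a := rfl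

instance : Module K (PresentedNUAlgebra r) where
  one_smul x := by
    obtain ⟨a, rfl⟩ := mk_surjective r x
    rw [← mk_smul, one_smul]
  mul_smul k l x := by
    obtain ⟨a, rfl⟩ := mk_surjective r x
    rw [← mk_smul, ← mk_smul, ← mk_smul, mul_smul]
  smul_zero k := by rw [← mk_zero, ← mk_smul, smul_zero]
  smul_add k x y := by
    obtain ⟨a, rfl⟩ := mk_surjective r x
    obtain ⟨b, rfl⟩ := mk_surjective r y
    rw [← mk_add, ← mk_smul, ← mk_smul, ← mk_smul, ← mk_add, smul_add]
  add_smul k l x := by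
    obtain ⟨a, rfl⟩ := mk_surjective r x
    rw [← mk_smul, ← mk_smul, ← mk_smul, ← mk_add, add_smul]
  zero_smul x := by
    obtain ⟨a, rfl⟩ := mk_surjective r x
    rw [← mk_smul, zero_smul, mk_zero]

instance : IsScalarTower K (PresentedNUAlgebra r) (PresentedNUAlgebra r) where
  smul_assoc k x y := by
    obtain ⟨a, rfl⟩ := mk_surjective r x
    obtain ⟨b, rfl⟩ := mk_surjective r y
    simp only [smul_eq_mul]
    rw [← mk_smul, ← mk_mul, ← mk_mul, ← mk_smul, smul_mul_assoc]

instance : SMulCommClass K (PresentedNUAlgebra r) (PresentedNUAlgebra r) where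
  smul_comm k x y := by
    obtain ⟨a, rfl⟩ := mk_surjective r x
    obtain ⟨b, rfl⟩ := mk_surjective r y
    simp only [smul_eq_mul]
    rw [← mk_smul, ← mk_mul, ← mk_mul, ← mk_smul, mul_smul_comm]

end PresentedNUAlgebra

/-! ### Hypergraphs and their Leavitt path algebras -/

/-- A (directed) hypergraph: the source and the range of a hyperedge are nonempty finite multisets
of vertices. -/
structure DirHypergraph where
  /-- the vertices -/
  Vert : Type u
  /-- the hyperedges -/
  Edge : Type v
  /-- the source of a hyperedge -/
  s : Edge → Multiset Vert
  /-- the range of a hyperedge -/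
  r : Edge → Multiset Vert
  s_ne : ∀ h, s h ≠ 0
  r_ne : ∀ h, r h ≠ 0

namespace DirHypergraph

/-- A choice, for every hyperedge `h`, of enumerations (with multiplicities)
`s(h) = {s(h)₁, …, s(h)ₘ}` and `r(h) = {r(h)₁, …, r(h)ₙ}`, where `m = |s(h)|` and `n = |r(h)|`. -/
structure Enumeration (H : DirHypergraph) where
  /-- `src h i` is the vertex `s(h)ᵢ` -/
  src : (h : H.Edge) → Fin (H.s h).card → H.Vert
  /-- `rng h j` is the vertex `r(h)ⱼ` -/
  rng : (h : H.Edge) → Fin (H.r h).card → H.Vert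
  src_spec : ∀ h, Finset.univ.val.map (src h) = H.s h
  rng_spec : ∀ h, Finset.univ.val.map (rng h) = H.r h

/-- Every multiset can be enumerated, so the enumerations exist. -/
theorem exists_enum {α : Type*} (m : Multiset α) :
    ∃ f : Fin m.card → α, Finset.univ.val.map f = m := by
  induction m using Quotient.inductionOn with
  | h l => exact ⟨l.get, (Fin.univ_val_map _).trans (congrArg _ (List.ofFn_get l))⟩

instance (H : DirHypergraph) : Nonempty H.Enumeration := by
  choose f hf using fun h => exists_enum (H.s h)
  choose g hg using fun h => exists_enum (H.r h)
  exact ⟨⟨f, g, hf, hg⟩⟩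

/-- Condition (A): some hyperedge has a source and a range of cardinality at least two. -/
def ConditionA (H : DirHypergraph) : Prop :=
  ∃ h : H.Edge, 2 ≤ (H.s h).card ∧ 2 ≤ (H.r h).card

/-- The generators `v`, `hᵢⱼ` and `hᵢⱼ*` of the Leavitt path algebra. -/
inductive Gen (H : DirHypergraph)
  | vert (v : H.Vert) : Gen H
  | edge (h : H.Edge) (i : Fin (H.s h).card) (j : Fin (H.r h).card) : Gen H
  | ghost (h : H.Edge) (i : Fin (H.s h).card) (j : Fin (H.r h).card) : Gen H

variable (K : Type*) [Field K] {H : DirHypergraph}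

/-- The generator `v` in the free algebra. -/
def v (x : H.Vert) : FreeNUAlgebra K H.Gen := FreeNUAlgebra.gen K (.vert x)

/-- The generator `hᵢⱼ` in the free algebra. -/
def e (h : H.Edge) (i : Fin (H.s h).card) (j : Fin (H.r h).card) : FreeNUAlgebra K H.Gen :=
  FreeNUAlgebra.gen K (.edge h i j)

/-- The generator `hᵢⱼ*` in the free algebra. -/
def e' (h : H.Edge) (i : Fin (H.s h).card) (j : Fin (H.r h).card) : FreeNUAlgebra K H.Gen :=
  FreeNUAlgebra.gen K (.ghost h i j)

open Classical in
/-- The defining relations of the Leavitt path algebra of a hypergraph. -/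
inductive LRel (ι : H.Enumeration) : FreeNUAlgebra K H.Gen → FreeNUAlgebra K H.Gen → Prop
  | vert (x y : H.Vert) : LRel ι (v K x * v K y) (if x = y then v K x else 0)
  | src_edge (h : H.Edge) (i : Fin (H.s h).card) (j : Fin (H.r h).card) :
      LRel ι (v K (ι.src h i) * e K h i j) (e K h i j)
  | edge_rng (h : H.Edge) (i : Fin (H.s h).card) (j : Fin (H.r h).card) :
      LRel ι (e K h i j * v K (ι.rng h j)) (e K h i j)
  | rng_ghost (h : H.Edge) (i : Fin (H.s h).card) (j : Fin (H.r h).card) :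
      LRel ι (v K (ι.rng h j) * e' K h i j) (e' K h i j)
  | ghost_src (h : H.Edge) (i : Fin (H.s h).card) (j : Fin (H.r h).card) :
      LRel ι (e' K h i j * v K (ι.src h i)) (e' K h i j)
  | sum_rng (h : H.Edge) (i j : Fin (H.s h).card) :
      LRel ι (∑ k, e K h i k * e' K h j k) (if i = j then v K (ι.src h i) else 0)
  | sum_src (h : H.Edge) (i j : Fin (H.r h).card) :
      LRel ι (∑ k, e' K h k i * e K h k j) (if i = j then v K (ι.rng h i) else 0)

/-- The Leavitt path algebra `L_K(H)` of the hypergraph `H`, formed with the enumerations `ι` of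
the sources and ranges. -/
abbrev LeavittPathAlgebra (H : DirHypergraph) (ι : H.Enumeration) : Type _ :=
  PresentedNUAlgebra (LRel K ι)

end DirHypergraph

/-! ### Separated graphs and their Leavitt path algebras -/

/-- A separated graph: a directed graph together with, for every vertex `v`, a partition `C v` of
the set of edges emitted by `v` into pairwise disjoint nonempty subsets. -/
structure SeparatedGraph where
  /-- the vertices -/
  Vert : Type u
  /-- the edges -/
  Edge : Type v
  /-- the source map -/
  s : Edge → Vert
  /-- the range map -/
  r : Edge → Vert
  /-- the partition of the set of edges emitted by a vertex -/
  C : Vert → Set (Set Edge)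
  C_nonempty : ∀ v, ∀ X ∈ C v, X.Nonempty
  C_disjoint : ∀ v, (C v).PairwiseDisjoint id
  C_sUnion : ∀ v, ⋃₀ C v = {e | s e = v}

namespace SeparatedGraph

/-- A separated graph is finitely separated if all the sets in the partitions are finite. -/
def IsFinitelySeparated (G : SeparatedGraph) : Prop :=
  ∀ v, ∀ X ∈ G.C v, X.Finite

/-- The generators `v`, `e` and `e*` of the Leavitt path algebra. -/
inductive Gen (G : SeparatedGraph)
  | vert (v : G.Vert) : Gen G
  | edge (e : G.Edge) : Gen G
  | ghost (e : G.Edge) : Gen G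

variable (K : Type*) [Field K] {G : SeparatedGraph}

/-- The generator `v` in the free algebra. -/
def v (x : G.Vert) : FreeNUAlgebra K G.Gen := FreeNUAlgebra.gen K (.vert x)

/-- The generator `e` in the free algebra. -/
def e (a : G.Edge) : FreeNUAlgebra K G.Gen := FreeNUAlgebra.gen K (.edge a)

/-- The generator `e*` in the free algebra. -/
def e' (a : G.Edge) : FreeNUAlgebra K G.Gen := FreeNUAlgebra.gen K (.ghost a)

open Classical in
/-- The defining relations of the Leavitt path algebra of a separated graph. -/
inductive LRel (G : SeparatedGraph) : FreeNUAlgebra K G.Gen → FreeNUAlgebra K G.Gen → Prop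
  | vert (x y : G.Vert) : LRel G (v K x * v K y) (if x = y then v K x else 0)
  | src_edge (a : G.Edge) : LRel G (v K (G.s a) * e K a) (e K a)
  | edge_rng (a : G.Edge) : LRel G (e K a * v K (G.r a)) (e K a)
  | rng_ghost (a : G.Edge) : LRel G (v K (G.r a) * e' K a) (e' K a)
  | ghost_src (a : G.Edge) : LRel G (e' K a * v K (G.s a)) (e' K a)
  | ghost_edge (x : G.Vert) (X : Set G.Edge) (hX : X ∈ G.C x) (a b : G.Edge) (ha : a ∈ X)
      (hb : b ∈ X) : LRel G (e' K a * e K b) (if a = b then v K (G.r a) else 0)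
  | sum_edge (x : G.Vert) (X : Set G.Edge) (hX : X ∈ G.C x) (hfin : X.Finite) :
      LRel G (v K x) (∑ a ∈ hfin.toFinset, e K a * e' K a)

/-- The Leavitt path algebra `L_K(E, C)` of a separated graph. -/
abbrev LeavittPathAlgebra (G : SeparatedGraph) : Type _ :=
  PresentedNUAlgebra (LRel K G)

end SeparatedGraph

/-! ### Ring-theoretic properties of rings that need not be unital -/

/-- Descending chain condition on left ideals. -/
def IsLeftArtinianRing (R : Type*) [NonUnitalRing R] : Prop :=
  WellFoundedLT {I : AddSubgroup R // ∀ a x : R, x ∈ I → a * x ∈ I}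

/-- Descending chain condition on right ideals. -/
def IsRightArtinianRing (R : Type*) [NonUnitalRing R] : Prop :=
  WellFoundedLT {I : AddSubgroup R // ∀ a x : R, x ∈ I → x * a ∈ I}

/-- A ring is von Neumann regular if for every `x` there is a `y` with `x y x = x`. -/
def IsVonNeumannRegularRing (R : Type*) [NonUnitalRing R] : Prop :=
  ∀ x : R, ∃ y : R, x * y * x = x

end

/-! Let `V` be the free `K[X]`-module of countable rank. Since `V` is isomorphic to `V ^ m` for
every `m ≥ 1`, there are invertible `m × n` matrices over `End V` for all `m, n ≥ 1`. Put a copy of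
`V` at each vertex, let the vertices act as the projections, and let `hᵢⱼ` and `hᵢⱼ*` act through
the entries of an invertible matrix and of its inverse. Relations 3 and 4 then say exactly that the
two matrices are mutually inverse, so any such choice gives a representation `ρ` of `L_K(H)` by
`K[X]`-linear maps.

If `m, n ≥ 2`, the matrix can be chosen so that the product of an entry and the transposed entry of
the inverse is the scalar `X` (`IsInvertibleRow.exists_matrix_succ`). Under Condition (A) some `x =
hᵢⱼhᵢⱼ*` thus has `ρ x = X e` with `e` the projection to a vertex summand. The ideals `{a | X ^ k ∣
ρ a}`, `k ≥ 1`, form a strictly descending chain, separated by the powers of `x`. This chain settles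
every claim in (a) except the last; for regularity, `x y x = x` would make `X e` divisible by `X ^
2`.

For (b), each of the listed properties excludes Condition (A), so every hyperedge has one side of
cardinality one. Its entries form a block of edges leaving that single vertex; if this vertex is the
range, `hᵢⱼ*` plays the role of the edge. The two presentations then agree
(`exists_bijective_hom_toGraph`). -/

noncomputable section

/-! ### Universal property of presented algebras -/

namespace PresentedNUAlgebra

variable {K X A : Type*} [Field K] {r : FreeNUAlgebra K X → FreeNUAlgebra K X → Prop}

theorem mk_eq_of_rel {a b : FreeNUAlgebra K X} (h : r a b) : mk r a = mk r b :=
  (presCon r).eq.2 (RingConGen.Rel.of _ _ ⟨1, a, b, h, (one_smul _ _).symm, (one_smul _ _).symm⟩)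

variable (r) in
/-- The quotient map as a homomorphism of algebras. -/
def mkHom : FreeNUAlgebra K X →ₙₐ[K] PresentedNUAlgebra r where
  toFun := mk r
  map_smul' _ _ := rfl
  map_zero' := rfl
  map_add' _ _ := rfl
  map_mul' _ _ := rfl

theorem mk_sum {ι : Type*} (s : Finset ι) (f : ι → FreeNUAlgebra K X) :
    mk r (∑ i ∈ s, f i) = ∑ i ∈ s, mk r (f i) :=
  map_sum (mkHom r) f s

theorem mk_ite_zero (p : Prop) [Decidable p] (a : FreeNUAlgebra K X) :
    mk r (if p then a else 0) = if p then mk r a else 0 := by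
  split_ifs <;> rfl

variable [NonUnitalRing A] [Module K A]

theorem hom_ext {f g : PresentedNUAlgebra r →ₙₐ[K] A}
    (h : ∀ x, f (mk r (FreeNUAlgebra.gen K x)) = g (mk r (FreeNUAlgebra.gen K x))) : f = g := by
  have key : f.comp (mkHom r) = g.comp (mkHom r) := by
    apply MonoidAlgebra.nonUnitalAlgHom_ext'
    apply FreeSemigroup.hom_ext
    funext x
    exact h x
  ext y
  obtain ⟨a, rfl⟩ := mk_surjective r y
  exact DFunLike.congr_fun key a

variable [IsScalarTower K A A] [SMulCommClass K A A]

variable (K) in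
/-- The homomorphism on the free algebra with prescribed values on the generators. -/
def freeLift (f : X → A) : FreeNUAlgebra K X →ₙₐ[K] A :=
  MonoidAlgebra.liftMagma K (FreeSemigroup.lift f)

@[simp] theorem freeLift_gen (f : X → A) (x : X) :
    freeLift K f (FreeNUAlgebra.gen K x) = f x := by
  simp [freeLift, FreeNUAlgebra.gen, MonoidAlgebra.liftMagma]

theorem freeLift_eq_of_presCon (f : X → A) (hf : ∀ a b, r a b → freeLift K f a = freeLift K f b)
    {a b : FreeNUAlgebra K X} (h : presCon r a b) : freeLift K f a = freeLift K f b := by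
  change RingConGen.Rel _ a b at h
  induction h with
  | of a b h =>
    obtain ⟨k, x, y, hr, rfl, rfl⟩ := h
    rw [map_smul, map_smul, hf x y hr]
  | refl x => rfl
  | symm _ ih => exact ih.symm
  | trans _ _ ih₁ ih₂ => exact ih₁.trans ih₂
  | add _ _ ih₁ ih₂ => rw [map_add, map_add, ih₁, ih₂]
  | mul _ _ ih₁ ih₂ => rw [map_mul, map_mul, ih₁, ih₂]

/-- The universal property of the presented algebra. -/
def lift (f : X → A) (hf : ∀ a b, r a b → freeLift K f a = freeLift K f b) :
    PresentedNUAlgebra r →ₙₐ[K] A where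
  toFun := fun x => Quotient.liftOn' x (freeLift K f) fun _ _ h => freeLift_eq_of_presCon f hf h
  map_smul' k x := by
    obtain ⟨a, rfl⟩ := mk_surjective r x
    exact map_smul (freeLift K f) k a
  map_zero' := map_zero (freeLift K f)
  map_add' x y := by
    obtain ⟨a, rfl⟩ := mk_surjective r x
    obtain ⟨b, rfl⟩ := mk_surjective r y
    exact map_add (freeLift K f) a b
  map_mul' x y := by
    obtain ⟨a, rfl⟩ := mk_surjective r x
    obtain ⟨b, rfl⟩ := mk_surjective r y
    exact map_mul (freeLift K f) a b

@[simp] theorem lift_gen (f : X → A) (hf : ∀ a b, r a b → freeLift K f a = freeLift K f b)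
    (x : X) : lift f hf (mk r (FreeNUAlgebra.gen K x)) = f x :=
  freeLift_gen f x

end PresentedNUAlgebra

/-! ### Chains of ideals from a central element -/

section CentralElement

variable {K L R : Type*} [Field K] [NonUnitalRing L] [Module K L] [Ring R] [Algebra K R]

/-- The ideal of the elements whose image is divisible by the `k`-th power of a central element. -/
def powIdeal (ρ : L →ₙₐ[K] R) (t : R) (ht : ∀ g, Commute t g) (k : ℕ) : TwoSidedIdeal L :=
  TwoSidedIdeal.mk' {a | t ^ k ∣ ρ a} (by simp)
    (fun {x y} hx hy => by simpa using dvd_add (Set.mem_ofPred.1 hx) (Set.mem_ofPred.1 hy))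
    (fun {x} hx => by simpa using hx)
    (fun {x y} ⟨g, hg⟩ => ⟨ρ x * g, by
      rw [map_mul, hg, ← mul_assoc, ← ((ht (ρ x)).pow_left k).eq, mul_assoc]⟩)
    (fun {x y} hx => by simpa using hx.mul_right (ρ y))

theorem mem_powIdeal {ρ : L →ₙₐ[K] R} {t : R} {ht : ∀ g, Commute t g} {k : ℕ} {a : L} :
    a ∈ powIdeal ρ t ht k ↔ t ^ k ∣ ρ a := by
  simp only [powIdeal, TwoSidedIdeal.mem_mk', Set.mem_ofPred_eq]

theorem powIdeal_antitone (ρ : L →ₙₐ[K] R) (t : R) (ht : ∀ g, Commute t g) :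
    Antitone (powIdeal ρ t ht) := fun _ _ hkl _ ha =>
  mem_powIdeal.2 ((pow_dvd_pow t hkl).trans (mem_powIdeal.1 ha))

/-- `x ^ (k + 1)`, in a ring that need not be unital. -/
def powSucc (x : L) : ℕ → L
  | 0 => x
  | k + 1 => x * powSucc x k

theorem map_powSucc {ρ : L →ₙₐ[K] R} {t e : R} (ht : ∀ g, Commute t g) (he : e * e = e) {x : L}
    (hx : ρ x = t * e) (k : ℕ) : ρ (powSucc x k) = t ^ (k + 1) * e := by
  induction k with
  | zero => simpa [powSucc] using hx
  | succ k ih =>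
    rw [powSucc, map_mul, hx, ih, mul_assoc, ← mul_assoc e, ← ((ht e).pow_left (k + 1)).eq,
      mul_assoc, he, ← mul_assoc, ← pow_succ']

/-- The element `powSucc x k`, with image `t ^ (k + 1) * e`, lies in the ideal of index `k + 1` but
not in the next one. The chain starts at exponent 1 because `x ^ 0` need not exist in `L`. -/
theorem powIdeal_strictAnti {ρ : L →ₙₐ[K] R} {t e : R} (ht : ∀ g, Commute t g) (he : e * e = e)
    {x : L} (hx : ρ x = t * e) (hte : ∀ k, ¬ t ^ (k + 1) ∣ t ^ k * e) :
    StrictAnti fun k => powIdeal ρ t ht (k + 1) := by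
  refine strictAnti_nat_of_succ_lt fun k => lt_of_le_not_ge
    (powIdeal_antitone ρ t ht (Nat.le_succ _)) fun hle => hte (k + 1) ?_
  have hk : powSucc x k ∈ powIdeal ρ t ht (k + 1) := by
    rw [mem_powIdeal, map_powSucc ht he hx]
    exact dvd_mul_right _ _
  have := hle hk
  rwa [mem_powIdeal, map_powSucc ht he hx] at this

theorem not_wellFoundedLT_of_strictAnti {α : Type*} [Preorder α] {f : ℕ → α} (hf : StrictAnti f) :
    ¬ WellFoundedLT α := fun h =>
  (RelEmbedding.natGT (r := ((· < ·) : α → α → Prop)) f fun n => hf n.lt_succ_self).not_wellFounded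
    h.wf

/-- Without a unit, a ring ideal need not be stable under scalars, so stability is a hypothesis. -/
theorem TwoSidedIdeal.exists_submodule {I : TwoSidedIdeal L} (hI : ∀ (k : K) a, a ∈ I → k • a ∈ I) :
    ∃ N : Submodule K L, ∀ a, a ∈ N ↔ a ∈ I :=
  ⟨{ carrier := I
     add_mem' := I.add_mem
     zero_mem' := I.zero_mem
     smul_mem' := fun k a => hI k a }, fun _ => Iff.rfl⟩

theorem TwoSidedIdeal.exists_addSubgroup (I : TwoSidedIdeal L) :
    ∃ N : AddSubgroup L, ∀ a, a ∈ N ↔ a ∈ I :=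
  ⟨{ carrier := I
     add_mem' := I.add_mem
     zero_mem' := I.zero_mem
     neg_mem' := I.neg_mem }, fun _ => Iff.rfl⟩

theorem infinite_of_map_eq_central_mul_idempotent {ρ : L →ₙₐ[K] R} {t e : R}
    (ht : ∀ g, Commute t g) (he : e * e = e) {x : L} (hx : ρ x = t * e)
    (hte : ∀ k, ¬ t ^ (k + 1) ∣ t ^ k * e) :
    ¬ FiniteDimensional K L ∧ Infinite (TwoSidedIdeal L) ∧ ¬ IsSimpleRing L ∧
      ¬ IsLeftArtinianRing L ∧ ¬ IsRightArtinianRing L ∧ ¬ IsVonNeumannRegularRing L := by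
  have hanti := powIdeal_strictAnti ht he hx hte
  have hinf : Infinite (TwoSidedIdeal L) := Infinite.of_injective _ hanti.injective
  choose N hN using fun k => (powIdeal ρ t ht (k + 1)).exists_addSubgroup
  have hNanti : StrictAnti N := fun k l hkl => by
    refine SetLike.lt_iff_le_and_exists.2 ?_
    simpa only [SetLike.le_def, hN] using SetLike.lt_iff_le_and_exists.1 (hanti hkl)
  refine ⟨fun hfin => ?_, hinf, fun hsimple => ?_, ?_, ?_, fun hreg => ?_⟩
  · choose M hM using fun k => (powIdeal ρ t ht (k + 1)).exists_submodule (K := K)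
      fun c a ha => by
        rw [mem_powIdeal] at ha ⊢
        obtain ⟨g, hg⟩ := ha
        exact ⟨c • g, by rw [map_smul, hg, mul_smul_comm]⟩
    have hManti : StrictAnti M := fun k l hkl => by
      refine SetLike.lt_iff_le_and_exists.2 ?_
      simpa only [SetLike.le_def, hM] using SetLike.lt_iff_le_and_exists.1 (hanti hkl)
    exact not_wellFoundedLT_of_strictAnti hManti inferInstance
  -- The ideal of exponent 2 lies strictly between those of exponents 3 and 1, so it is neither zero
  -- nor everything.
  · rcases hsimple.simple.eq_bot_or_eq_top (powIdeal ρ t ht (1 + 1)) with h | h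
    · exact (hanti (Nat.lt_succ_self 1)).not_ge (h.le.trans bot_le)
    · exact (hanti Nat.zero_lt_one).not_ge (le_top.trans h.ge)
  · exact not_wellFoundedLT_of_strictAnti (f := fun k =>
      (⟨N k, fun a x hx => (hN k _).2 (TwoSidedIdeal.mul_mem_left _ _ _ ((hN k _).1 hx))⟩ :
        {I : AddSubgroup L // ∀ a x : L, x ∈ I → a * x ∈ I})) fun k l hkl => hNanti hkl
  · exact not_wellFoundedLT_of_strictAnti (f := fun k =>
      (⟨N k, fun a x hx => (hN k _).2 (TwoSidedIdeal.mul_mem_right _ _ _ ((hN k _).1 hx))⟩ :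
        {I : AddSubgroup L // ∀ a x : L, x ∈ I → x * a ∈ I})) fun k l hkl => hNanti hkl
  -- Applying `ρ` to `x y x = x` gives `t e = t ^ 2 (e ρ(y) e)`, because `t` is central.
  · obtain ⟨y, hy⟩ := hreg x
    refine hte 1 ⟨e * ρ y * e, ?_⟩
    rw [pow_one, ← hx]
    nth_rw 1 [← hy]
    rw [map_mul, map_mul, hx, mul_assoc, ← mul_assoc (ρ y), ← (ht (ρ y)).eq, pow_succ, pow_one]
    simp only [mul_assoc]
    rw [← mul_assoc e t, ← (ht e).eq]
    simp only [mul_assoc]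

end CentralElement

/-! ### Invertible rectangular matrices -/

section InvertibleMatrices

open Matrix

/-- `P` is a row and `Q` a column such that `P Q` and `Q P` are identity matrices. -/
def IsInvertibleRow {S : Type*} [Ring S] {m : ℕ} (P Q : Fin m → S) : Prop :=
  ∑ j, P j * Q j = 1 ∧ ∀ i j, Q i * P j = if i = j then 1 else 0

variable {S : Type*} [Ring S]

/-- The products `Q P'` and `Q' P` are inverse to each other: the inner factors `P' Q'` and `P Q`
cancel to 1. -/
theorem IsInvertibleRow.exists_matrix {m n : ℕ} {P Q : Fin m → S} {P' Q' : Fin n → S}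
    (h : IsInvertibleRow P Q) (h' : IsInvertibleRow P' Q') :
    ∃ (A : Matrix (Fin m) (Fin n) S) (B : Matrix (Fin n) (Fin m) S), A * B = 1 ∧ B * A = 1 := by
  refine ⟨.of fun i j => Q i * P' j, .of fun j i => Q' j * P i, ?_, ?_⟩
  · ext i j
    simp only [mul_apply, of_apply, one_apply, ← h.2 i j]
    calc ∑ k, Q i * P' k * (Q' k * P j) = Q i * (∑ k, P' k * Q' k) * P j := by
          simp only [Finset.mul_sum, Finset.sum_mul, mul_assoc]
      _ = _ := by rw [h'.1, mul_one]
  · ext i j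
    simp only [mul_apply, of_apply, one_apply, ← h'.2 i j]
    calc ∑ k, Q' i * P k * (Q k * P' j) = Q' i * (∑ k, P k * Q k) * P' j := by
          simp only [Finset.mul_sum, Finset.sum_mul, mul_assoc]
      _ = _ := by rw [h.1, mul_one]

/-- The matrices are obtained from the block matrix `!![t, t - 1; 1, 1]` and its inverse
`!![1, 1 - t; -1, t]`. -/
theorem IsInvertibleRow.exists_matrix_succ {m n : ℕ} {P Q : Fin m → S} {P' Q' : Fin n → S}
    (h : IsInvertibleRow P Q) (h' : IsInvertibleRow P' Q') {t : S} (ht : ∀ g, Commute t g) :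
    ∃ (A : Matrix (Fin (m + 1)) (Fin (n + 1)) S) (B : Matrix (Fin (n + 1)) (Fin (m + 1)) S),
      A * B = 1 ∧ B * A = 1 ∧ A 0 0 * B 0 0 = t := by
  -- The first matrix is `diag(1, Q) * !![t, t - 1; 1, 1] * diag(1, P')`, and the second is `diag(1,
  -- Q') * !![1, 1 - t; -1, t] * diag(1, P)`. The outer factors enlarge the lower right entry to an
  -- `m × n` or `n × m` block and leave the corner entries `t` and `1` untouched.
  refine ⟨.of (Fin.cons (Fin.cons t fun j => (t - 1) * P' j)
      fun i => Fin.cons (Q i) fun j => Q i * P' j),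
    .of (Fin.cons (Fin.cons 1 fun j => (1 - t) * P j)
      fun i => Fin.cons (-Q' i) fun j => t * (Q' i * P j)), ?_, ?_, by simp⟩
  · have key (x y : S) : ∑ k, x * P' k * (Q' k * y) = x * y := by
      calc _ = x * (∑ k, P' k * Q' k) * y := by
            simp only [Finset.mul_sum, Finset.sum_mul, mul_assoc]
        _ = _ := by rw [h'.1, mul_one]
    have key₁ (x : S) : ∑ k, x * P' k * Q' k = x := by simpa using key x 1
    have key₂ (x y : S) : ∑ k, x * P' k * (t * (Q' k * y)) = t * (x * y) := by
      rw [← key x y, Finset.mul_sum]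
      exact Finset.sum_congr rfl fun k _ => by rw [← mul_assoc, ← (ht (x * P' k)).eq, mul_assoc]
    ext i j
    refine Fin.cases ?_ (fun i => ?_) i <;> refine Fin.cases ?_ (fun j => ?_) j
    · simp [mul_apply, Fin.sum_univ_succ, key₁]
    · simp [mul_apply, Fin.sum_univ_succ, key₂, one_apply, (Fin.succ_ne_zero _).symm]
      noncomm_ring
    · simp [mul_apply, Fin.sum_univ_succ, key₁, one_apply]
    · simp [mul_apply, Fin.sum_univ_succ, key₂, one_apply, ← h.2 i j]
      rw [← mul_assoc (Q i), mul_sub, ← (ht (Q i)).eq]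
      noncomm_ring
  · have key (x y : S) : ∑ k, x * P k * (Q k * y) = x * y := by
      calc _ = x * (∑ k, P k * Q k) * y := by
            simp only [Finset.mul_sum, Finset.sum_mul, mul_assoc]
        _ = _ := by rw [h.1, mul_one]
    have key₁ (x : S) : ∑ k, x * P k * Q k = x := by simpa using key x 1
    have key₂ (y : S) : ∑ k, P k * (Q k * y) = y := by simpa using key 1 y
    ext i j
    refine Fin.cases ?_ (fun i => ?_) i <;> refine Fin.cases ?_ (fun j => ?_) j
    · simp [mul_apply, Fin.sum_univ_succ, key₁]
    · simp [mul_apply, Fin.sum_univ_succ, key, one_apply, (Fin.succ_ne_zero _).symm]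
      noncomm_ring
    · simp [mul_apply, Fin.sum_univ_succ, ← mul_assoc, key₁, one_apply, (ht (Q' i)).eq]
    · simp [mul_apply, Fin.sum_univ_succ, one_apply, ← h'.2 i j, mul_assoc, ← Finset.mul_sum, key₂]
      rw [← mul_assoc t, (ht (Q' i)).eq]
      noncomm_ring

/-- A bijection between `ℕ` and `Fin m × ℕ` identifies `ℕ →₀ A` with the direct sum of `m` copies of
itself. The row consists of the inclusions of the summands and the column of the projections. -/
theorem exists_isInvertibleRow_end (A : Type*) [CommRing A] (m : ℕ) [NeZero m] :
    ∃ P Q : Fin m → Module.End A (ℕ →₀ A), IsInvertibleRow P Q := by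
  let e : (ℕ →₀ A) ≃ₗ[A] (Fin m → ℕ →₀ A) :=
    Finsupp.domLCongr (nonempty_equiv_of_countable (α := ℕ) (β := Fin m × ℕ)).some ≪≫ₗ
      Finsupp.curryLinearEquiv A ≪≫ₗ Finsupp.linearEquivFunOnFinite A _ _
  refine ⟨fun j => e.symm.toLinearMap ∘ₗ LinearMap.single A (fun _ => ℕ →₀ A) j,
    fun j => LinearMap.proj j ∘ₗ e.toLinearMap, ?_, fun i j => ?_⟩
  · ext1 a
    ext1
    apply e.injective
    simp only [LinearMap.sum_apply, Module.End.mul_apply, LinearMap.comp_apply]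
    funext k
    simp [Finset.sum_apply, Pi.single_apply]
  · ext1 a
    ext1
    by_cases h : i = j
    · subst h; simp
    · simp [h]

end InvertibleMatrices

/-! ### Matrix units on a direct sum indexed by the vertices -/

section MatrixUnits

variable {A V U : Type*} [CommRing A] [AddCommGroup V] [Module A V]

/-- The endomorphism of a direct sum of copies of `V` that maps the summand at `w` to the summand
at `u` by means of `a`. -/
def matUnit (u w : U) : Module.End A V →+ Module.End A (U →₀ V) where
  toFun a := Finsupp.lsingle u ∘ₗ a ∘ₗ Finsupp.lapply w
  map_zero' := by ext; simp
  map_add' a b := by ext; simp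

theorem matUnit_apply (u w : U) (a : Module.End A V) (f : U →₀ V) :
    matUnit u w a f = Finsupp.single u (a (f w)) := rfl

theorem matUnit_mul_same (u w z : U) (a b : Module.End A V) :
    matUnit u w a * matUnit w z b = matUnit u z (a * b) := by
  ext1 x
  ext1
  simp [matUnit_apply]

theorem matUnit_mul_of_ne {u w w' z : U} (h : w ≠ w') (a b : Module.End A V) :
    matUnit u w a * matUnit w' z b = 0 := by
  ext1 x
  ext1
  simp [matUnit_apply, h]

end MatrixUnits

/-! ### The representation and Condition (A) -/

namespace DirHypergraph

open Matrix Polynomial PresentedNUAlgebra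

section Representation

variable {K A V : Type*} [Field K] [CommRing A] [Algebra K A] [AddCommGroup V] [Module A V]
  [Module K V] [IsScalarTower K A V] {H : DirHypergraph}

theorem exists_inverse_matrices
    (hV : ∀ (m : ℕ) [NeZero m], ∃ P Q : Fin m → Module.End A V, IsInvertibleRow P Q) (t : A)
    (h : H.Edge) :
    ∃ (M : Matrix (Fin (H.s h).card) (Fin (H.r h).card) (Module.End A V))
      (N : Matrix (Fin (H.r h).card) (Fin (H.s h).card) (Module.End A V)),
      M * N = 1 ∧ N * M = 1 ∧ (2 ≤ (H.s h).card → 2 ≤ (H.r h).card →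
        ∃ i j, M i j * N j i = algebraMap A _ t) := by
  have hs := Multiset.card_pos.2 (H.s_ne h)
  have hr := Multiset.card_pos.2 (H.r_ne h)
  generalize (H.s h).card = m at *
  generalize (H.r h).card = n at *
  by_cases hmn : 2 ≤ m ∧ 2 ≤ n
  · obtain ⟨m, rfl⟩ := Nat.exists_eq_add_of_le' hmn.1
    obtain ⟨n, rfl⟩ := Nat.exists_eq_add_of_le' hmn.2
    -- The cardinalities are now `m + 2` and `n + 2`; the block construction adds one row and one
    -- column to sizes `m + 1` and `n + 1`, which are nonzero as `hV` requires.
    obtain ⟨P, Q, hPQ⟩ := hV (m + 1)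
    obtain ⟨P', Q', hPQ'⟩ := hV (n + 1)
    obtain ⟨M, N, hMN, hNM, h00⟩ := hPQ.exists_matrix_succ hPQ' fun g => Algebra.commutes t g
    exact ⟨M, N, hMN, hNM, fun _ _ => ⟨0, 0, h00⟩⟩
  · have := NeZero.of_pos hs
    have := NeZero.of_pos hr
    obtain ⟨P, Q, hPQ⟩ := hV m
    obtain ⟨P', Q', hPQ'⟩ := hV n
    obtain ⟨M, N, hMN, hNM⟩ := hPQ.exists_matrix hPQ'
    exact ⟨M, N, hMN, hNM, fun h₁ h₂ => (hmn ⟨h₁, h₂⟩).elim⟩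

theorem exists_representation (ι : H.Enumeration)
    (hV : ∀ (m : ℕ) [NeZero m], ∃ P Q : Fin m → Module.End A V, IsInvertibleRow P Q) (t : A)
    {h : H.Edge} (hs : 2 ≤ (H.s h).card) (hr : 2 ≤ (H.r h).card) :
    ∃ (ρ : H.LeavittPathAlgebra K ι →ₙₐ[K] Module.End A (H.Vert →₀ V))
      (x : H.LeavittPathAlgebra K ι) (u : H.Vert),
      ρ x = algebraMap A _ t * matUnit u u 1 := by
  choose M N hMN hNM hX using exists_inverse_matrices hV t (H := H)
  obtain ⟨i, j, hij⟩ := hX h hs hr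
  -- The ghost `hᵢⱼ*` takes the transposed entry `N h j i`, so that relations 3 and 4 become the
  -- entries of `M * N = 1` and `N * M = 1`.
  let φ : H.Gen → Module.End A (H.Vert →₀ V) := fun
    | .vert u => matUnit u u 1
    | .edge h i j => matUnit (ι.src h i) (ι.rng h j) (M h i j)
    | .ghost h i j => matUnit (ι.rng h j) (ι.src h i) (N h j i)
  have hφ : ∀ a b, LRel K ι a b → freeLift K φ a = freeLift K φ b := by
    rintro _ _ (⟨x, y⟩ | ⟨h, i, j⟩ | ⟨h, i, j⟩ | ⟨h, i, j⟩ | ⟨h, i, j⟩ | ⟨h, i, j⟩ | ⟨h, i, j⟩)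
    · by_cases hxy : x = y
      · subst hxy
        simp [v, φ, matUnit_mul_same]
      · simp [v, φ, matUnit_mul_of_ne hxy, hxy]
    · simp [v, e, φ, matUnit_mul_same]
    · simp [v, e, φ, matUnit_mul_same]
    · simp [v, e', φ, matUnit_mul_same]
    · simp [v, e', φ, matUnit_mul_same]
    · have := congrFun₂ (hMN h) i j
      rw [mul_apply, one_apply] at this
      simp only [map_sum, map_mul, e, e', freeLift_gen, φ, matUnit_mul_same]
      rw [← map_sum, this]
      by_cases hij : i = j
      · subst hij
        simp [v]
      · simp [hij]
    · have := congrFun₂ (hNM h) i j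
      rw [mul_apply, one_apply] at this
      simp only [map_sum, map_mul, e, e', freeLift_gen, φ, matUnit_mul_same]
      rw [← map_sum, this]
      by_cases hij : i = j
      · subst hij
        simp [v]
      · simp [hij]
  refine ⟨lift φ hφ, PresentedNUAlgebra.mk (LRel K ι) (e K h i j) *
      PresentedNUAlgebra.mk (LRel K ι) (e' K h i j), ι.src h i, ?_⟩
  rw [map_mul, e, e', lift_gen, lift_gen]
  simp only [φ, matUnit_mul_same, hij]
  ext1 w
  ext1
  simp [matUnit_apply, Module.algebraMap_end_apply]

/-- The vector `x₀` witnesses that `t ^ k * e` is not divisible by `t ^ (k + 1)`: a factorization,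
evaluated at the copy of `x₀` in the summand at `u`, would put `t ^ k • x₀` into `t ^ (k + 1) V`. -/
theorem ConditionA.infinite_aux (hA : H.ConditionA) (ι : H.Enumeration)
    (hV : ∀ (m : ℕ) [NeZero m], ∃ P Q : Fin m → Module.End A V, IsInvertibleRow P Q) (t : A)
    (x₀ : V) (hx₀ : ∀ (k : ℕ) y, t ^ k • x₀ ≠ t ^ (k + 1) • y) :
    ¬ FiniteDimensional K (H.LeavittPathAlgebra K ι) ∧
      Infinite (TwoSidedIdeal (H.LeavittPathAlgebra K ι)) ∧
      ¬ IsSimpleRing (H.LeavittPathAlgebra K ι) ∧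
      ¬ IsLeftArtinianRing (H.LeavittPathAlgebra K ι) ∧
      ¬ IsRightArtinianRing (H.LeavittPathAlgebra K ι) ∧
      ¬ IsVonNeumannRegularRing (H.LeavittPathAlgebra K ι) := by
  obtain ⟨h, hs, hr⟩ := hA
  obtain ⟨ρ, x, u, hx⟩ := exists_representation (K := K) ι hV t hs hr
  refine infinite_of_map_eq_central_mul_idempotent (fun g => Algebra.commutes t g)
    ((matUnit_mul_same _ _ _ _ _).trans (by rw [one_mul])) hx ?_
  rintro k ⟨g, hg⟩
  have := congr($hg (Finsupp.single u x₀) u)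
  rw [← map_pow, ← map_pow] at this
  simp only [Module.End.mul_apply, Module.algebraMap_end_apply, matUnit_apply, Finsupp.smul_apply,
    Finsupp.single_eq_same, Module.End.one_apply] at this
  exact hx₀ k _ this

theorem ConditionA.infinite (K : Type*) [Field K] (hA : H.ConditionA) (ι : H.Enumeration) :
    ¬ FiniteDimensional K (H.LeavittPathAlgebra K ι) ∧
      Infinite (TwoSidedIdeal (H.LeavittPathAlgebra K ι)) ∧
      ¬ IsSimpleRing (H.LeavittPathAlgebra K ι) ∧
      ¬ IsLeftArtinianRing (H.LeavittPathAlgebra K ι) ∧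
      ¬ IsRightArtinianRing (H.LeavittPathAlgebra K ι) ∧
      ¬ IsVonNeumannRegularRing (H.LeavittPathAlgebra K ι) := by
  refine hA.infinite_aux (A := K[X]) (V := ℕ →₀ K[X]) ι
    (fun m _ => exists_isInvertibleRow_end K[X] m) X (Finsupp.single 0 1) fun k y hy => ?_
  -- The coordinate at 0 reads `X ^ k = X ^ (k + 1) * y 0`; cancelling `X ^ k` would make `X` a unit
  -- of `K[X]`.
  have := DFunLike.congr_fun hy 0
  simp only [Finsupp.smul_apply, Finsupp.single_eq_same, smul_eq_mul, pow_succ, mul_assoc] at this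
  exact not_isUnit_X (IsUnit.of_mul_eq_one _ (mul_left_cancel₀ (pow_ne_zero k X_ne_zero) this).symm)

end Representation

end DirHypergraph

/-! ### Orthogonality of the vertex idempotents -/

theorem SeparatedGraph.mk_v_mul_self {G : SeparatedGraph} (K : Type*) [Field K] (x : G.Vert) :
    PresentedNUAlgebra.mk (SeparatedGraph.LRel K G) (SeparatedGraph.v K x) *
        PresentedNUAlgebra.mk _ (SeparatedGraph.v K x) =
      PresentedNUAlgebra.mk _ (SeparatedGraph.v K x) := by
  have := PresentedNUAlgebra.mk_eq_of_rel (SeparatedGraph.LRel.vert (K := K) (G := G) x x)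
  rwa [if_pos rfl] at this

theorem SeparatedGraph.mk_v_mul_of_ne {G : SeparatedGraph} (K : Type*) [Field K]
    {x y : G.Vert} (h : x ≠ y) :
    PresentedNUAlgebra.mk (SeparatedGraph.LRel K G) (SeparatedGraph.v K x) *
        PresentedNUAlgebra.mk _ (SeparatedGraph.v K y) = 0 := by
  have := PresentedNUAlgebra.mk_eq_of_rel (SeparatedGraph.LRel.vert (K := K) (G := G) x y)
  rwa [if_neg h] at this

theorem DirHypergraph.mk_v_mul_self {H : DirHypergraph} (ι : H.Enumeration) (K : Type*) [Field K] (x : H.Vert) :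
    PresentedNUAlgebra.mk (DirHypergraph.LRel K ι) (DirHypergraph.v K x) *
        PresentedNUAlgebra.mk _ (DirHypergraph.v K x) =
      PresentedNUAlgebra.mk _ (DirHypergraph.v K x) := by
  have := PresentedNUAlgebra.mk_eq_of_rel (DirHypergraph.LRel.vert (K := K) (ι := ι) x x)
  rwa [if_pos rfl] at this

theorem DirHypergraph.mk_v_mul_of_ne {H : DirHypergraph} (ι : H.Enumeration) (K : Type*) [Field K] {x y : H.Vert} (h : x ≠ y) :
    PresentedNUAlgebra.mk (DirHypergraph.LRel K ι) (DirHypergraph.v K x) *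
        PresentedNUAlgebra.mk _ (DirHypergraph.v K y) = 0 := by
  have := PresentedNUAlgebra.mk_eq_of_rel (DirHypergraph.LRel.vert (K := K) (ι := ι) x y)
  rwa [if_neg h] at this

/-! ### The separated graph of a hypergraph without Condition (A) -/

namespace DirHypergraph

section ToGraph

open PresentedNUAlgebra

variable {H : DirHypergraph.{u, v}} (ι : H.Enumeration)

theorem card_r_of_not_conditionA (hH : ¬ H.ConditionA) {h : H.Edge} (hs : (H.s h).card ≠ 1) :
    (H.r h).card = 1 := by
  have h₁ := Multiset.card_pos.2 (H.s_ne h)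
  have h₂ := Multiset.card_pos.2 (H.r_ne h)
  by_contra hr
  exact hH ⟨h, by omega, by omega⟩

theorem Fin.eq_of_card_eq_one {n : ℕ} (hn : n = 1) (i j : Fin n) : i = j := by
  subst hn
  exact Subsingleton.elim i j

/-- The source of the edge of the separated graph attached to the entry `(i, j)` of `h`. -/
def graphSrc (a : Σ h : H.Edge, Fin (H.s h).card × Fin (H.r h).card) : H.Vert :=
  if (H.s a.1).card = 1 then ι.src a.1 a.2.1 else ι.rng a.1 a.2.2

/-- The source is read off from a side of cardinality one, so it depends on the hyperedge alone. The
failure of Condition (A) ensures this when `|s(h)| ≠ 1`, and it makes the entries of `h` a single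
block of the partition. -/
theorem graphSrc_eq (hH : ¬ H.ConditionA)
    {a b : Σ h : H.Edge, Fin (H.s h).card × Fin (H.r h).card} (hab : a.1 = b.1) :
    graphSrc ι a = graphSrc ι b := by
  obtain ⟨h, i, j⟩ := a
  obtain ⟨_, k, l⟩ := b
  subst hab
  by_cases hs : (H.s h).card = 1
  · simp only [graphSrc, hs, if_true, Fin.eq_of_card_eq_one hs i k]
  · simp only [graphSrc, hs, if_false,
      Fin.eq_of_card_eq_one (card_r_of_not_conditionA hH hs) j l]

/-- The separated graph of a hypergraph in which all hyperedges have a source or a range of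
cardinality one: the entries of a hyperedge become edges, directed away from the vertex that is its
source or its range. -/
def toGraph (hH : ¬ H.ConditionA) : SeparatedGraph.{u, v} where
  Vert := H.Vert
  Edge := Σ h : H.Edge, Fin (H.s h).card × Fin (H.r h).card
  s := graphSrc ι
  r a := if (H.s a.1).card = 1 then ι.rng a.1 a.2.2 else ι.src a.1 a.2.1
  C x := {Y | ∃ h, Y = {a | a.1 = h} ∧ ∀ a ∈ Y, graphSrc ι a = x}
  C_nonempty := by
    rintro x _ ⟨h, rfl, -⟩
    exact ⟨⟨h, ⟨0, Multiset.card_pos.2 (H.s_ne h)⟩, ⟨0, Multiset.card_pos.2 (H.r_ne h)⟩⟩, rfl⟩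
  C_disjoint := by
    rintro x _ ⟨h, rfl, -⟩ _ ⟨h', rfl, -⟩ hne
    refine Set.disjoint_left.2 fun a ha ha' => hne ?_
    have : h = h' := Eq.trans (Eq.symm ha) ha'
    rw [this]
  C_sUnion := by
    intro x
    ext a
    constructor
    · rintro ⟨_, ⟨h, rfl, hx⟩, ha⟩
      exact hx a ha
    · intro ha
      exact ⟨{b | b.1 = a.1}, ⟨a.1, rfl, fun b hb => (graphSrc_eq ι hH hb).trans ha⟩, rfl⟩

variable (hH : ¬ H.ConditionA)

theorem toGraph_isFinitelySeparated : (toGraph ι hH).IsFinitelySeparated := by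
  rintro x _ ⟨h, rfl, -⟩
  refine (Set.finite_range fun p : Fin (H.s h).card × Fin (H.r h).card =>
    (⟨h, p⟩ : (toGraph ι hH).Edge)).subset ?_
  rintro ⟨_, p⟩ rfl
  exact ⟨p, rfl⟩

/-- The edge of the separated graph attached to the entry `(i, j)` of `h`. -/
def toGraphEdge (h : H.Edge) (i : Fin (H.s h).card) (j : Fin (H.r h).card) :
    (toGraph ι hH).Edge := ⟨h, i, j⟩

/-- The set of the edges of the separated graph attached to the entries of `h`. -/
def toGraphEdges (h : H.Edge) : Set (toGraph ι hH).Edge := {a | a.1 = h}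

variable {ι hH}

theorem toGraphEdge_inj {h : H.Edge} {i k : Fin (H.s h).card} {j l : Fin (H.r h).card} :
    toGraphEdge ι hH h i j = toGraphEdge ι hH h k l ↔ i = k ∧ j = l := by
  refine ⟨fun h => ?_, fun ⟨h₁, h₂⟩ => by rw [h₁, h₂]⟩
  simpa using eq_of_heq (Sigma.mk.inj h).2

theorem toGraph_s_pos {h : H.Edge} (hs : (H.s h).card = 1) (i : Fin (H.s h).card)
    (j : Fin (H.r h).card) : (toGraph ι hH).s (toGraphEdge ι hH h i j) = ι.src h i := if_pos hs

theorem toGraph_s_neg {h : H.Edge} (hs : (H.s h).card ≠ 1) (i : Fin (H.s h).card)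
    (j : Fin (H.r h).card) : (toGraph ι hH).s (toGraphEdge ι hH h i j) = ι.rng h j := if_neg hs

theorem toGraph_r_pos {h : H.Edge} (hs : (H.s h).card = 1) (i : Fin (H.s h).card)
    (j : Fin (H.r h).card) : (toGraph ι hH).r (toGraphEdge ι hH h i j) = ι.rng h j := if_pos hs

theorem toGraph_r_neg {h : H.Edge} (hs : (H.s h).card ≠ 1) (i : Fin (H.s h).card)
    (j : Fin (H.r h).card) : (toGraph ι hH).r (toGraphEdge ι hH h i j) = ι.src h i := if_neg hs

theorem toGraphEdge_mem (h : H.Edge) (i : Fin (H.s h).card) (j : Fin (H.r h).card) :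
    toGraphEdge ι hH h i j ∈ toGraphEdges ι hH h := rfl

theorem toGraphEdges_mem (h : H.Edge) (i : Fin (H.s h).card) (j : Fin (H.r h).card) :
    toGraphEdges ι hH h ∈ (toGraph ι hH).C ((toGraph ι hH).s (toGraphEdge ι hH h i j)) :=
  ⟨h, rfl, fun _ ha => graphSrc_eq ι hH ha⟩

/-- Splitting the sum over a block into two indices serves both orientations: the index on the side
of cardinality one later disappears. -/
theorem sum_toGraphEdges {M : Type*} [AddCommMonoid M] (h : H.Edge)
    (hfin : (toGraphEdges ι hH h).Finite) (f : (toGraph ι hH).Edge → M) :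
    ∑ a ∈ hfin.toFinset, f a = ∑ i, ∑ j, f (toGraphEdge ι hH h i j) := by
  rw [← Fintype.sum_prod_type']
  refine (Finset.sum_bij (fun p _ => toGraphEdge ι hH h p.1 p.2) ?_ ?_ ?_ ?_).symm
  · intro p _
    exact hfin.mem_toFinset.2 (toGraphEdge_mem h p.1 p.2)
  · intro p _ q _ hpq
    exact Prod.ext_iff.2 (toGraphEdge_inj.1 hpq)
  · intro a ha
    obtain ⟨_, p⟩ := a
    obtain rfl := hfin.mem_toFinset.1 ha
    exact ⟨p, Finset.mem_univ _, rfl⟩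
  · intro p _
    rfl

variable (K : Type*) [Field K]

theorem toGraph_ghost_mul_edge (h : H.Edge) (i k : Fin (H.s h).card) (j l : Fin (H.r h).card) :
    PresentedNUAlgebra.mk
        (SeparatedGraph.LRel K (toGraph ι hH)) (SeparatedGraph.e' K (toGraphEdge ι hH h i j)) *
      PresentedNUAlgebra.mk _ (SeparatedGraph.e K (toGraphEdge ι hH h k l)) =
    if i = k ∧ j = l then PresentedNUAlgebra.mk _
        (SeparatedGraph.v K ((toGraph ι hH).r (toGraphEdge ι hH h i j)))
      else 0 := by
  have := mk_eq_of_rel (SeparatedGraph.LRel.ghost_edge (K := K) _ _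
    (toGraphEdges_mem (ι := ι) (hH := hH) h i j) _ _ (toGraphEdge_mem h i j)
        (toGraphEdge_mem h k l))
  rw [mk_mul, mk_ite_zero] at this
  rw [this]
  classical exact if_congr toGraphEdge_inj rfl rfl

theorem toGraph_sum_edge_mul_ghost (h : H.Edge) (i : Fin (H.s h).card) (j : Fin (H.r h).card) :
    ∑ k, ∑ l, PresentedNUAlgebra.mk (SeparatedGraph.LRel K (toGraph ι hH))
        (SeparatedGraph.e K (toGraphEdge ι hH h k l)) *
      PresentedNUAlgebra.mk _ (SeparatedGraph.e' K (toGraphEdge ι hH h k l)) =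
    PresentedNUAlgebra.mk _ (SeparatedGraph.v K ((toGraph ι hH).s (toGraphEdge ι hH h i j))) := by
  have hX := toGraphEdges_mem (ι := ι) (hH := hH) h i j
  rw [mk_eq_of_rel (SeparatedGraph.LRel.sum_edge (K := K) _ _ hX
    (toGraph_isFinitelySeparated ι hH _ _ hX)), mk_sum, sum_toGraphEdges]
  rfl

/-! ### The isomorphism of the two Leavitt path algebras -/

variable (ι hH)

/-- The images of the generators of the Leavitt path algebra of a hypergraph in that of the
separated graph. -/
def genToGraph : H.Gen → (toGraph ι hH).LeavittPathAlgebra K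
  | .vert x => PresentedNUAlgebra.mk _ (SeparatedGraph.v K (G := toGraph ι hH) x)
  | .edge h i j =>
      if (H.s h).card = 1 then PresentedNUAlgebra.mk _ (SeparatedGraph.e K (toGraphEdge ι hH h i j))
      else PresentedNUAlgebra.mk _ (SeparatedGraph.e' K (toGraphEdge ι hH h i j))
  | .ghost h i j =>
      if (H.s h).card = 1 then PresentedNUAlgebra.mk _ (SeparatedGraph.e' K (toGraphEdge ι hH h i j))
      else PresentedNUAlgebra.mk _ (SeparatedGraph.e K (toGraphEdge ι hH h i j))

theorem genToGraph_rel (a b : FreeNUAlgebra K H.Gen) (hab : LRel K ι a b) :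
    freeLift K (genToGraph ι hH K) a = freeLift K (genToGraph ι hH K) b := by
  obtain ⟨x, y⟩ | ⟨h, i, j⟩ | ⟨h, i, j⟩ | ⟨h, i, j⟩ | ⟨h, i, j⟩ | ⟨h, i, j⟩ | ⟨h, i, j⟩ := hab
  · by_cases hxy : x = y
    · subst hxy
      simpa [v, genToGraph] using SeparatedGraph.mk_v_mul_self (G := toGraph ι hH) K x
    · simpa [v, genToGraph, hxy] using
        SeparatedGraph.mk_v_mul_of_ne (G := toGraph ι hH) K hxy
  -- If `|s(h)| = 1`, each relation matches the one of the same shape, with relation 3 giving the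
  -- sum over the block and relation 4 the orthogonality of its edges. Otherwise `|r(h)| = 1`; edges
  -- and ghosts trade places, as do sources and ranges, and so do the roles of relations 3 and 4.
  all_goals by_cases hs : (H.s h).card = 1
  · have := mk_eq_of_rel (SeparatedGraph.LRel.src_edge (K := K) (toGraphEdge ι hH h i j))
    rw [mk_mul, toGraph_s_pos hs] at this
    simpa [v, e, genToGraph, hs] using this
  · have := mk_eq_of_rel (SeparatedGraph.LRel.rng_ghost (K := K) (toGraphEdge ι hH h i j))
    rw [mk_mul, toGraph_r_neg hs] at this
    simpa [v, e, genToGraph, hs] using this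
  · have := mk_eq_of_rel (SeparatedGraph.LRel.edge_rng (K := K) (toGraphEdge ι hH h i j))
    rw [mk_mul, toGraph_r_pos hs] at this
    simpa [v, e, genToGraph, hs] using this
  · have := mk_eq_of_rel (SeparatedGraph.LRel.ghost_src (K := K) (toGraphEdge ι hH h i j))
    rw [mk_mul, toGraph_s_neg hs] at this
    simpa [v, e, genToGraph, hs] using this
  · have := mk_eq_of_rel (SeparatedGraph.LRel.rng_ghost (K := K) (toGraphEdge ι hH h i j))
    rw [mk_mul, toGraph_r_pos hs] at this
    simpa [v, e', genToGraph, hs] using this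
  · have := mk_eq_of_rel (SeparatedGraph.LRel.src_edge (K := K) (toGraphEdge ι hH h i j))
    rw [mk_mul, toGraph_s_neg hs] at this
    simpa [v, e', genToGraph, hs] using this
  · have := mk_eq_of_rel (SeparatedGraph.LRel.ghost_src (K := K) (toGraphEdge ι hH h i j))
    rw [mk_mul, toGraph_s_pos hs] at this
    simpa [v, e', genToGraph, hs] using this
  · have := mk_eq_of_rel (SeparatedGraph.LRel.edge_rng (K := K) (toGraphEdge ι hH h i j))
    rw [mk_mul, toGraph_r_neg hs] at this
    simpa [v, e', genToGraph, hs] using this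
  · obtain rfl := Fin.eq_of_card_eq_one hs i j
    have := toGraph_sum_edge_mul_ghost (hH := hH) (ι := ι) K h i
      ⟨0, Multiset.card_pos.2 (H.r_ne h)⟩
    have _ : Subsingleton (Fin (H.s h).card) := ⟨Fin.eq_of_card_eq_one hs⟩
    rw [toGraph_s_pos hs, Fintype.sum_subsingleton _ i] at this
    simpa [v, e, e', genToGraph, hs] using this
  · have hr := card_r_of_not_conditionA hH hs
    have _ : Subsingleton (Fin (H.r h).card) := ⟨Fin.eq_of_card_eq_one hr⟩
    have k : Fin (H.r h).card := ⟨0, hr ▸ Nat.one_pos⟩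
    have := toGraph_ghost_mul_edge (hH := hH) (ι := ι) K h i j k k
    rw [toGraph_r_neg hs] at this
    rw [Fintype.sum_subsingleton _ k]
    by_cases hij : i = j
    · subst hij
      simpa [v, e, e', genToGraph, hs] using this
    · simpa [v, e, e', genToGraph, hs, hij] using this
  · have _ : Subsingleton (Fin (H.s h).card) := ⟨Fin.eq_of_card_eq_one hs⟩
    have k : Fin (H.s h).card := ⟨0, hs ▸ Nat.one_pos⟩
    have := toGraph_ghost_mul_edge (hH := hH) (ι := ι) K h k k i j
    rw [toGraph_r_pos hs] at this
    rw [Fintype.sum_subsingleton _ k]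
    by_cases hij : i = j
    · subst hij
      simpa [v, e, e', genToGraph, hs] using this
    · simpa [v, e, e', genToGraph, hs, hij] using this
  · have hr := card_r_of_not_conditionA hH hs
    obtain rfl := Fin.eq_of_card_eq_one hr i j
    have := toGraph_sum_edge_mul_ghost (hH := hH) (ι := ι) K h
      ⟨0, Multiset.card_pos.2 (H.s_ne h)⟩ i
    have _ : Subsingleton (Fin (H.r h).card) := ⟨Fin.eq_of_card_eq_one hr⟩
    simp only [Fintype.sum_subsingleton _ i, toGraph_s_neg hs] at this
    simpa [v, e, e', genToGraph, hs] using this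

/-- The images of the generators of the Leavitt path algebra of the separated graph in that of the
hypergraph. -/
def genOfGraph : (toGraph ι hH).Gen → H.LeavittPathAlgebra K ι
  | .vert x => PresentedNUAlgebra.mk _ (v K (H := H) x)
  | .edge ⟨h, i, j⟩ => if (H.s h).card = 1 then PresentedNUAlgebra.mk _ (e K h i j)
      else PresentedNUAlgebra.mk _ (e' K h i j)
  | .ghost ⟨h, i, j⟩ => if (H.s h).card = 1 then PresentedNUAlgebra.mk _ (e' K h i j)
      else PresentedNUAlgebra.mk _ (e K h i j)

theorem sum_mk_edge_mul_ghost (h : H.Edge) (i j : Fin (H.s h).card) :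
    ∑ k, PresentedNUAlgebra.mk (LRel K ι) (e K h i k) * PresentedNUAlgebra.mk _ (e' K h j k) =
      if i = j then PresentedNUAlgebra.mk _ (v K (ι.src h i)) else 0 := by
  have := mk_eq_of_rel (LRel.sum_rng (K := K) (ι := ι) h i j)
  rwa [mk_sum, mk_ite_zero] at this

theorem sum_mk_ghost_mul_edge (h : H.Edge) (i j : Fin (H.r h).card) :
    ∑ k, PresentedNUAlgebra.mk (LRel K ι) (e' K h k i) * PresentedNUAlgebra.mk _ (e K h k j) =
      if i = j then PresentedNUAlgebra.mk _ (v K (ι.rng h i)) else 0 := by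
  have := mk_eq_of_rel (LRel.sum_src (K := K) (ι := ι) h i j)
  rwa [mk_sum, mk_ite_zero] at this

theorem exists_eq_toGraphEdge (a : (toGraph ι hH).Edge) : ∃ h i j, a = toGraphEdge ι hH h i j :=
  ⟨a.1, a.2.1, a.2.2, rfl⟩

theorem freeLift_genOfGraph_v (x : (toGraph ι hH).Vert) :
    freeLift K (genOfGraph ι hH K) (SeparatedGraph.v K x) =
      PresentedNUAlgebra.mk _ (v K (H := H) x) :=
  freeLift_gen _ _

theorem freeLift_genOfGraph_e (h : H.Edge) (i : Fin (H.s h).card) (j : Fin (H.r h).card) :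
    freeLift K (genOfGraph ι hH K) (SeparatedGraph.e K (toGraphEdge ι hH h i j)) =
      if (H.s h).card = 1 then PresentedNUAlgebra.mk _ (e K h i j)
      else PresentedNUAlgebra.mk _ (e' K h i j) :=
  freeLift_gen _ _

theorem freeLift_genOfGraph_e' (h : H.Edge) (i : Fin (H.s h).card) (j : Fin (H.r h).card) :
    freeLift K (genOfGraph ι hH K) (SeparatedGraph.e' K (toGraphEdge ι hH h i j)) =
      if (H.s h).card = 1 then PresentedNUAlgebra.mk _ (e' K h i j)
      else PresentedNUAlgebra.mk _ (e K h i j) :=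
  freeLift_gen _ _

theorem genOfGraph_rel (a b : FreeNUAlgebra K (toGraph ι hH).Gen)
    (hab : SeparatedGraph.LRel K _ a b) :
    freeLift K (genOfGraph ι hH K) a = freeLift K (genOfGraph ι hH K) b := by
  obtain ⟨x, y⟩ | a | a | a | a | ⟨x, _, ⟨h, rfl, hX⟩, a, b, ha, hb⟩ |
    ⟨x, _, ⟨h, rfl, hX⟩, hfin⟩ := hab
  · by_cases hxy : x = y
    · subst hxy
      simpa [freeLift_genOfGraph_v] using mk_v_mul_self ι K (H := H) x
    · simpa [freeLift_genOfGraph_v, hxy] using mk_v_mul_of_ne ι K (H := H) hxy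
  · obtain ⟨h, i, j, rfl⟩ := exists_eq_toGraphEdge ι hH a
    rw [map_mul, freeLift_genOfGraph_v, freeLift_genOfGraph_e]
    by_cases hs : (H.s h).card = 1
    · rw [if_pos hs, toGraph_s_pos hs]
      exact mk_eq_of_rel (LRel.src_edge h i j)
    · rw [if_neg hs, toGraph_s_neg hs]
      exact mk_eq_of_rel (LRel.rng_ghost h i j)
  · obtain ⟨h, i, j, rfl⟩ := exists_eq_toGraphEdge ι hH a
    rw [map_mul, freeLift_genOfGraph_v, freeLift_genOfGraph_e]
    by_cases hs : (H.s h).card = 1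
    · rw [if_pos hs, toGraph_r_pos hs]
      exact mk_eq_of_rel (LRel.edge_rng h i j)
    · rw [if_neg hs, toGraph_r_neg hs]
      exact mk_eq_of_rel (LRel.ghost_src h i j)
  · obtain ⟨h, i, j, rfl⟩ := exists_eq_toGraphEdge ι hH a
    rw [map_mul, freeLift_genOfGraph_v, freeLift_genOfGraph_e']
    by_cases hs : (H.s h).card = 1
    · rw [if_pos hs, toGraph_r_pos hs]
      exact mk_eq_of_rel (LRel.rng_ghost h i j)
    · rw [if_neg hs, toGraph_r_neg hs]
      exact mk_eq_of_rel (LRel.src_edge h i j)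
  · obtain ⟨h, i, j, rfl⟩ := exists_eq_toGraphEdge ι hH a
    rw [map_mul, freeLift_genOfGraph_v, freeLift_genOfGraph_e']
    by_cases hs : (H.s h).card = 1
    · rw [if_pos hs, toGraph_s_pos hs]
      exact mk_eq_of_rel (LRel.ghost_src h i j)
    · rw [if_neg hs, toGraph_s_neg hs]
      exact mk_eq_of_rel (LRel.edge_rng h i j)
  · obtain ⟨h₁, i, j, rfl⟩ := exists_eq_toGraphEdge ι hH a
    obtain ⟨h₂, k, l, rfl⟩ := exists_eq_toGraphEdge ι hH b
    have ha_eq : h₁ = h := ha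
    have hb_eq : h₂ = h := hb
    clear ha hb hX
    subst ha_eq
    subst hb_eq
    rename' h₂ => h
    -- Both edges now belong to the same `h`, and equality of edges means equality of both indices.
    -- The index on the side of cardinality one agrees automatically, leaving the Kronecker delta of
    -- relation 4 or 3.
    rw [map_mul, apply_ite (freeLift K (genOfGraph ι hH K)), map_zero]
    simp only [toGraphEdge_inj]
    rw [freeLift_genOfGraph_v, freeLift_genOfGraph_e, freeLift_genOfGraph_e']
    by_cases hs : (H.s h).card = 1
    · have _ : Subsingleton (Fin (H.s h).card) := ⟨Fin.eq_of_card_eq_one hs⟩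
      obtain rfl := Subsingleton.elim i k
      have := sum_mk_ghost_mul_edge ι K h j l
      rw [Fintype.sum_subsingleton _ i] at this
      simpa [toGraph_r_pos hs, hs] using this
    · have hr := card_r_of_not_conditionA hH hs
      have _ : Subsingleton (Fin (H.r h).card) := ⟨Fin.eq_of_card_eq_one hr⟩
      obtain rfl := Subsingleton.elim j l
      have := sum_mk_edge_mul_ghost ι K h i k
      rw [Fintype.sum_subsingleton _ j] at this
      simpa [toGraph_r_neg hs, hs] using this
  · have i : Fin (H.s h).card := ⟨0, Multiset.card_pos.2 (H.s_ne h)⟩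
    have j : Fin (H.r h).card := ⟨0, Multiset.card_pos.2 (H.r_ne h)⟩
    -- The block is nonempty, so its base vertex is the source of any of its edges.
    obtain rfl := hX (toGraphEdge ι hH h i j) rfl
    have hsum := sum_toGraphEdges (ι := ι) (hH := hH) h hfin fun a =>
      SeparatedGraph.e K a * SeparatedGraph.e' K a
    refine Eq.trans ?_ (congrArg _ hsum.symm)
    refine (freeLift_genOfGraph_v ι hH K _).trans ?_
    simp only [map_sum, map_mul, freeLift_genOfGraph_e, freeLift_genOfGraph_e']
    by_cases hs : (H.s h).card = 1
    · have _ : Subsingleton (Fin (H.s h).card) := ⟨Fin.eq_of_card_eq_one hs⟩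
      have := sum_mk_edge_mul_ghost ι K h i i
      rw [if_pos rfl] at this
      rw [Fintype.sum_subsingleton _ i]
      simp only [if_pos hs]
      rw [this]
      exact congrArg (fun y => PresentedNUAlgebra.mk _ (v K y)) (if_pos hs)
    · have hr := card_r_of_not_conditionA hH hs
      have _ : Subsingleton (Fin (H.r h).card) := ⟨Fin.eq_of_card_eq_one hr⟩
      have := sum_mk_ghost_mul_edge ι K h j j
      rw [if_pos rfl] at this
      simp only [Fintype.sum_subsingleton _ j, if_neg hs]
      rw [this]
      exact congrArg (fun y => PresentedNUAlgebra.mk _ (v K y)) (if_neg hs)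

/-- The two assignments of generators are inverse to each other: a hyperedge whose source does not
have cardinality one exchanges edges and ghosts in both directions, and the exchanges cancel. -/
theorem exists_bijective_hom_toGraph :
    ∃ f : H.LeavittPathAlgebra K ι →ₙₐ[K] (toGraph ι hH).LeavittPathAlgebra K,
      Function.Bijective f := by
  let f := lift (r := LRel K ι) (genToGraph ι hH K) (genToGraph_rel ι hH K)
  let g := lift (r := SeparatedGraph.LRel K (toGraph ι hH)) (genOfGraph ι hH K)
    (genOfGraph_rel ι hH K)
  have hgf : g.comp f = NonUnitalAlgHom.id K _ := by
    refine hom_ext fun x => ?_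
    rw [NonUnitalAlgHom.comp_apply, lift_gen]
    obtain x | ⟨h, i, j⟩ | ⟨h, i, j⟩ := x
    · exact lift_gen _ _ _
    all_goals
      by_cases hs : (H.s h).card = 1
      · simp only [genToGraph, hs, if_true]
        refine (lift_gen _ _ _).trans ?_
        simp only [genOfGraph, toGraphEdge, hs, if_true]
        rfl
      · simp only [genToGraph, hs, if_false]
        refine (lift_gen _ _ _).trans ?_
        simp only [genOfGraph, toGraphEdge, hs, if_false]
        rfl
  have hfg : f.comp g = NonUnitalAlgHom.id K _ := by
    refine hom_ext fun x => ?_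
    rw [NonUnitalAlgHom.comp_apply, lift_gen]
    obtain x | ⟨h, i, j⟩ | ⟨h, i, j⟩ := x
    · exact lift_gen _ _ _
    all_goals
      by_cases hs : (H.s h).card = 1
      · simp only [genOfGraph, hs, if_true]
        refine (lift_gen _ _ _).trans ?_
        simp only [genToGraph, hs, if_true]
        rfl
      · simp only [genOfGraph, hs, if_false]
        refine (lift_gen _ _ _).trans ?_
        simp only [genToGraph, hs, if_false]
        rfl
  exact ⟨f, Function.bijective_iff_has_inverse.2
    ⟨g, DFunLike.congr_fun hgf, DFunLike.congr_fun hfg⟩⟩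

end ToGraph

end DirHypergraph

end

theorem mainTheorem7 (K : Type w) [Field K] (H : DirHypergraph.{u, v})
    (ι : H.Enumeration) :
    (H.ConditionA →
      ¬ FiniteDimensional K (H.LeavittPathAlgebra K ι) ∧
      Infinite (TwoSidedIdeal (H.LeavittPathAlgebra K ι)) ∧
      ¬ IsSimpleRing (H.LeavittPathAlgebra K ι) ∧
      ¬ IsLeftArtinianRing (H.LeavittPathAlgebra K ι) ∧
      ¬ IsRightArtinianRing (H.LeavittPathAlgebra K ι) ∧
      ¬ IsVonNeumannRegularRing (H.LeavittPathAlgebra K ι)) ∧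
    ((FiniteDimensional K (H.LeavittPathAlgebra K ι) ∨
      Finite (TwoSidedIdeal (H.LeavittPathAlgebra K ι)) ∨
      IsSimpleRing (H.LeavittPathAlgebra K ι) ∨
      IsLeftArtinianRing (H.LeavittPathAlgebra K ι) ∨
      IsRightArtinianRing (H.LeavittPathAlgebra K ι) ∨
      IsVonNeumannRegularRing (H.LeavittPathAlgebra K ι)) →
      ∃ G : SeparatedGraph.{u, v}, G.IsFinitelySeparated ∧
        ∃ f : H.LeavittPathAlgebra K ι →ₙₐ[K] G.LeavittPathAlgebra K, Function.Bijective f) := by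
  refine ⟨fun hA => hA.infinite K ι, fun h => ?_⟩
  have hH : ¬ H.ConditionA := fun hA => by
    obtain ⟨h₁, h₂, h₃, h₄, h₅, h₆⟩ := hA.infinite K ι
    rcases h with h | h | h | h | h | h
    · exact h₁ h
    · exact not_finite (TwoSidedIdeal (H.LeavittPathAlgebra K ι))
    · exact h₃ h
    · exact h₄ h
    · exact h₅ h
    · exact h₆ h
  exact ⟨_, DirHypergraph.toGraph_isFinitelySeparated ι hH,
    DirHypergraph.exists_bijective_hom_toGraph ι hH K⟩
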